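/- Let $\mathcal S,\mathcal A$ be measurable spaces and consider a constrained Markov decision process with transition kernel $P(\cdot\mid s,a)$, initial distribution $\rho$ on $\mathcal S$, discount factor $\gamma\in(0,1)$, measurable reward $r_0:\mathcal S\times\mathcal A\to[0,1]$ and measurable utilities $r_1,\dots,r_m:\mathcal S\times\mathcal A\to[-1,1]$. For a stationary stochastic policy $\pi$ (a probability kernel from $\mathcal S$ to $\mathcal A$) let $$V_i^\pi(\rho)=\mathbb E\Big[\sum_{t\ge0}\gamma^t r_i(s_t,a_t)\Big],\qquad s_0\sim\rho,\ a_t\sim\pi(\cdot\mid s_t),\ s_{t+1}\sim P(\cdot\mid s_t,a_t),$$ let $V_i^\pi(s)$ and $Q_i^\pi(s,a)$ be the same expectation started from $s_0=s$, respectively from $(s_0,a_0)=(s,a)$, let $A_i^\pi(s,a)=Q_i^\pi(s,a)-V_i^\pi(s)$, and let $d_\rho^\pi=(1-\gamma)\sum_{t\ge0}\gamma^t\,\mathrm{Law}(s_t,a_t)$. Let $\pi^*$ be a stationary policy that maximizes $V_0^\pi(\rho)$ over all stationary policies $\pi$ with $V_i^\pi(\rho)\ge0$ for $i=1,\dots,m$.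 Let $\{\pi_\theta\}_{\theta\in\mathbb R^d}$ be a parameterized family of stationary policies with positive densities $\pi_\theta(a\mid s)$, measurable in $(s,a)$, with respect to a $\sigma$-finite reference measure on $\mathcal A$, such that $\theta\mapsto\log\pi_\theta(a\mid s)$ is differentiable for all $s,a$. Write $V_i^\theta=V_i^{\pi_\theta}(\rho)$, $A_i^\theta=A_i^{\pi_\theta}$, $d_\rho^\theta=d_\rho^{\pi_\theta}$, and put $$\Theta=\{\theta: V_i^\theta\ge0,\ i=1,\dots,m\},\qquad B_\eta^\theta=V_0^\theta+\eta\sum_{i=1}^m\log V_i^\theta,$$ $$F^\theta=\mathbb E_{(s,a)\sim d_\rho^\theta}\big[\nabla_\theta\log\pi_\theta(a\mid s)\,\nabla_\theta\log\pi_\theta(a\mid s)^{T}\big],\qquad \mu_i^*=(F^\theta)^{\dagger}\,\nabla_\theta V_i^\theta ,$$ where $\dagger$ is the Moore--Penrose pseudoinverse. Suppose that $\|\nabla_\theta\log\pi_\theta(a\mid s)\|\le M_g$ for all $\theta\in\Theta$ and all $s,a$. Let $\eta>0$ and let $\theta\in\Theta$ satisfy $V_i^\theta>0$ for $i=1,\dots,m$.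 Let $\mu_F>0$ be a lower bound for all non-zero eigenvalues of $F^\theta$, and let $\varepsilon_{bias}$ be such that $$\mathbb E_{(s,a)\sim d_\rho^{\pi^*}}\Big[\big(A_i^\theta(s,a)-(1-\gamma)(\mu_i^*)^{T}\nabla_\theta\log\pi_\theta(a\mid s)\big)^2\Big]\le\varepsilon_{bias},\qquad i=0,\dots,m .$$ Then $V_0^\theta,\dots,V_m^\theta$ and $B_\eta^\theta$ are differentiable at $\theta$, and $$V_0^{\pi^*}(\rho)-V_0^\theta\ \le\ m\eta+\frac{\sqrt{\varepsilon_{bias}}}{1-\gamma}\Big(1+\sum_{i=1}^m\frac{\eta}{V_i^\theta}\Big)+\frac{M_g}{\mu_F}\,\big\|\nabla_\theta B_\eta^\theta\big\| .$$ -/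

import Mathlib

open MeasureTheory ProbabilityTheory

noncomputable section

/-- A discounted constrained Markov decision process on measurable state and action spaces, with
`m` constraints: transition kernel `P`, initial law `ρ`, reward `r 0` with values in `[0, 1]`,
utilities `r 1, …, r m` with values in `[-1, 1]`, and discount factor `γ ∈ (0, 1)`. -/
structure CMDP (S A : Type*) [MeasurableSpace S] [MeasurableSpace A] (m : ℕ) where
  P : Kernel (S × A) S
  isMarkovKernel_P : IsMarkovKernel P
  ρ : Measure S
  isProbabilityMeasure_ρ : IsProbabilityMeasure ρ
  r : Fin (m + 1) → S × A → ℝ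
  measurable_r : ∀ i, Measurable (r i)
  reward_mem : ∀ x, r 0 x ∈ Set.Icc (0 : ℝ) 1
  utility_mem : ∀ (i : Fin m) x, r i.succ x ∈ Set.Icc (-1 : ℝ) 1
  γ : ℝ
  γ_mem : γ ∈ Set.Ioo (0 : ℝ) 1

attribute [instance] CMDP.isMarkovKernel_P CMDP.isProbabilityMeasure_ρ

/-- A parameterized family of stationary stochastic policies `π_θ`, `θ ∈ ℝ^d`, given by positive
densities `π_θ(a|s)` with respect to a reference measure on the action space (the counting measure
for a discrete action space, Lebesgue measure for a continuous one), such that `log π_θ(a|s)` is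
differentiable in `θ`. -/
structure PolicyClass (S A : Type*) [MeasurableSpace S] [MeasurableSpace A] (d : ℕ) where
  ref : Measure A
  sigmaFinite_ref : SigmaFinite ref
  dens : EuclideanSpace ℝ (Fin d) → S → A → ℝ
  dens_pos : ∀ θ s a, 0 < dens θ s a
  measurable_dens : ∀ θ, Measurable (Function.uncurry (dens θ))
  lintegral_dens : ∀ θ s, ∫⁻ a, ENNReal.ofReal (dens θ s a) ∂ref = 1
  differentiable_log_dens : ∀ s a, Differentiable ℝ fun θ => Real.log (dens θ s a)

attribute [instance] PolicyClass.sigmaFinite_ref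

namespace PolicyClass

variable {S A : Type*} [MeasurableSpace S] [MeasurableSpace A] {d : ℕ}

/-- The policy `π_θ : S → Δ(A)`. -/
def policy (p : PolicyClass S A d) (θ : EuclideanSpace ℝ (Fin d)) : Kernel S A :=
  (Kernel.const S p.ref).withDensity fun s a => ENNReal.ofReal (p.dens θ s a)

theorem policy_apply (p : PolicyClass S A d) (θ : EuclideanSpace ℝ (Fin d)) (s : S) :
    p.policy θ s = p.ref.withDensity fun a => ENNReal.ofReal (p.dens θ s a) := by
  rw [policy, Kernel.withDensity_apply _ (p.measurable_dens θ).ennreal_ofReal, Kernel.const_apply]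

instance isMarkovKernel_policy (p : PolicyClass S A d) (θ : EuclideanSpace ℝ (Fin d)) :
    IsMarkovKernel (p.policy θ) := by
  refine ⟨fun s => ⟨?_⟩⟩
  rw [policy_apply, withDensity_apply _ MeasurableSet.univ, Measure.restrict_univ]
  exact p.lintegral_dens θ s

/-- The score `∇_θ log π_θ(a|s)`. -/
def score (p : PolicyClass S A d) (θ : EuclideanSpace ℝ (Fin d)) (x : S × A) :
    EuclideanSpace ℝ (Fin d) :=
  gradient (fun θ' => Real.log (p.dens θ' x.1 x.2)) θ

end PolicyClass

/-- The Moore–Penrose pseudoinverse of a symmetric real matrix: in an orthonormal eigenbasis it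
inverts the nonzero eigenvalues and keeps the zero ones. -/
def symmPinv {d : ℕ} (F : Matrix (Fin d) (Fin d) ℝ) : Matrix (Fin d) (Fin d) ℝ :=
  cfc (fun x : ℝ => x⁻¹) F

namespace CMDP

variable {S A : Type*} [MeasurableSpace S] [MeasurableSpace A] {m d : ℕ}

/-- One step of the state-action chain under the policy `π`:
`s' ~ P(·|s, a)` and then `a' ~ π(·|s')`. -/
def step (M : CMDP S A m) (π : Kernel S A) [IsMarkovKernel π] : Kernel (S × A) (S × A) :=
  M.P ⊗ₖ Kernel.prodMkLeft (S × A) π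

instance isMarkovKernel_step (M : CMDP S A m) (π : Kernel S A) [IsMarkovKernel π] :
    IsMarkovKernel (M.step π) := by
  unfold step; infer_instance

/-- The law of the trajectory `((s_0, a_0), (s_1, a_1), …)` under the policy `π` when
`(s_0, a_0)` has law `ν`. -/
def trajLaw (M : CMDP S A m) (π : Kernel S A) [IsMarkovKernel π] (ν : Measure (S × A)) :
    Measure (ℕ → S × A) :=
  Kernel.trajMeasure (X := fun _ => S × A) ν fun n =>
    (M.step π).comap (fun h : (i : Finset.Iic n) → S × A => h ⟨n, Finset.mem_Iic.2 le_rfl⟩)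
      (measurable_pi_apply _)

/-- The discounted return `∑_t γ^t r_i(s_t, a_t)` of a trajectory. -/
def discountedReturn (M : CMDP S A m) (i : Fin (m + 1)) (τ : ℕ → S × A) : ℝ :=
  ∑' t, M.γ ^ t * M.r i (τ t)

/-- The performance measure `V_i^π(ρ)`. -/
def value (M : CMDP S A m) (π : Kernel S A) [IsMarkovKernel π] (i : Fin (m + 1)) : ℝ :=
  ∫ τ, M.discountedReturn i τ ∂(M.trajLaw π (M.ρ ⊗ₘ π))

/-- The state value function `V_i^π(s)`. -/
def stateValue (M : CMDP S A m) (π : Kernel S A) [IsMarkovKernel π] (i : Fin (m + 1)) (s : S) :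
    ℝ :=
  ∫ τ, M.discountedReturn i τ ∂(M.trajLaw π (Measure.dirac s ⊗ₘ π))

/-- The state-action value function `Q_i^π(s, a)`. -/
def actionValue (M : CMDP S A m) (π : Kernel S A) [IsMarkovKernel π] (i : Fin (m + 1))
    (x : S × A) : ℝ :=
  ∫ τ, M.discountedReturn i τ ∂(M.trajLaw π (Measure.dirac x))

/-- The advantage function `A_i^π(s, a) = Q_i^π(s, a) - V_i^π(s)`. -/
def advantage (M : CMDP S A m) (π : Kernel S A) [IsMarkovKernel π] (i : Fin (m + 1))
    (x : S × A) : ℝ :=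
  M.actionValue π i x - M.stateValue π i x.1

/-- The discounted state-action visitation distribution
`d_ρ^π = (1 - γ) ∑_t γ^t Law(s_t, a_t)`. -/
def visitation (M : CMDP S A m) (π : Kernel S A) [IsMarkovKernel π] : Measure (S × A) :=
  Measure.sum fun t : ℕ =>
    ENNReal.ofReal ((1 - M.γ) * M.γ ^ t) • (M.trajLaw π (M.ρ ⊗ₘ π)).map fun τ => τ t

/-- `π` is an optimal stationary policy: it maximizes `V_0^π(ρ)` over all stationary stochastic
policies that satisfy the constraints `V_i^π(ρ) ≥ 0`, `i = 1, …, m`. -/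
def IsOptimalPolicy (M : CMDP S A m) (π : Kernel S A) [IsMarkovKernel π] : Prop :=
  (∀ i : Fin m, 0 ≤ M.value π i.succ) ∧
    ∀ (π' : Kernel S A) [IsMarkovKernel π'], (∀ i : Fin m, 0 ≤ M.value π' i.succ) →
      M.value π' 0 ≤ M.value π 0

/-- `V_i^θ(ρ)` as a function of `θ`. -/
def paramValue (M : CMDP S A m) (p : PolicyClass S A d) (i : Fin (m + 1))
    (θ : EuclideanSpace ℝ (Fin d)) : ℝ :=
  M.value (p.policy θ) i

/-- The feasible parameter set `Θ`. -/
def feasible (M : CMDP S A m) (p : PolicyClass S A d) : Set (EuclideanSpace ℝ (Fin d)) :=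
  {θ | ∀ i : Fin m, 0 ≤ M.paramValue p i.succ θ}

/-- The log barrier function `B_η^θ(ρ)`. -/
def logBarrier (M : CMDP S A m) (p : PolicyClass S A d) (η : ℝ)
    (θ : EuclideanSpace ℝ (Fin d)) : ℝ :=
  M.paramValue p 0 θ + η * ∑ i : Fin m, Real.log (M.paramValue p i.succ θ)

/-- The Fisher information matrix `F^θ(ρ)`. -/
def fisher (M : CMDP S A m) (p : PolicyClass S A d) (θ : EuclideanSpace ℝ (Fin d)) :
    Matrix (Fin d) (Fin d) ℝ :=
  Matrix.of fun j k => ∫ x, p.score θ x j * p.score θ x k ∂(M.visitation (p.policy θ))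

/-- `μ_i^* = F^θ(ρ)^† ∇_θ V_i^θ(ρ)`. -/
def naturalGradient (M : CMDP S A m) (p : PolicyClass S A d) (i : Fin (m + 1))
    (θ : EuclideanSpace ℝ (Fin d)) : EuclideanSpace ℝ (Fin d) :=
  Matrix.toEuclideanLin (symmPinv (M.fisher p θ)) (gradient (M.paramValue p i) θ)

/-- The transfer error `L(μ_i^*, θ, d_ρ^{π'})`. -/
def transferError (M : CMDP S A m) (p : PolicyClass S A d) (π' : Kernel S A) [IsMarkovKernel π']
    (i : Fin (m + 1)) (θ : EuclideanSpace ℝ (Fin d)) : ℝ :=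
  ∫ x, (M.advantage (p.policy θ) i x
      - (1 - M.γ) * inner ℝ (M.naturalGradient p i θ) (p.score θ x)) ^ 2 ∂(M.visitation π')

/-- The score is bounded by `Mg` on the feasible set. -/
def BoundedScore (M : CMDP S A m) (p : PolicyClass S A d) (Mg : ℝ) : Prop :=
  ∀ θ ∈ M.feasible p, ∀ x, ‖p.score θ x‖ ≤ Mg

/-- Every nonzero eigenvalue of the Fisher information matrix at `θ` is at least `μF`. -/
def RelaxedFisherNondegenerateAt (M : CMDP S A m) (p : PolicyClass S A d)
    (θ : EuclideanSpace ℝ (Fin d)) (μF : ℝ) : Prop :=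
  ∀ ev : ℝ, Module.End.HasEigenvalue (Matrix.toLin' (M.fisher p θ)) ev → ev ≠ 0 → μF ≤ ev

/-- The transfer errors of the reward and of all utilities at `θ` are at most `ε`. -/
def BoundedTransferErrorAt (M : CMDP S A m) (p : PolicyClass S A d) (πstar : Kernel S A)
    [IsMarkovKernel πstar] (θ : EuclideanSpace ℝ (Fin d)) (ε : ℝ) : Prop :=
  ∀ i, M.transferError p πstar i θ ≤ ε

end CMDP

end

/-! The performance difference lemma writes `(1 - γ)` times the gap `V_i^{π*} - V_i^θ` as the mean
of `A_i^θ` under the visitation law of `π*`. Replacing `A_i^θ` by `(1 - γ)⟨μ_i^*, score⟩` costs at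
most `√ε_bias` by Jensen, so `V_i^{π*} - V_i^θ ≤ √ε_bias / (1 - γ) + ⟨μ_i^*, g⟩`, where `g`, the
mean score under `π*`, is the same vector for every `i` (`value_sub_paramValue_le`).

Weight these inequalities by `1` for the reward and `η / V_i^θ` for the utilities. These are the
coefficients in `∇B_η^θ`, so the vectors `μ_i^*` combine to `F^† ∇B_η^θ`, and its product with `g`
is at most `(M_g / μ_F) ‖∇B_η^θ‖`. Feasibility of `π*` makes each weighted utility gap at least
`-η`, which gives the term `mη`.

Differentiability has to be proved with a score bound available only on `Θ`. Continuity of `V_i` is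
obtained without that bound, by Scheffé's lemma, so a neighbourhood of `θ` lies in `Θ`. There the
bound dominates the first-order remainder, and the policy gradient theorem follows. -/

theorem integral_measure_comp {X Y : Type*} [MeasurableSpace X] [MeasurableSpace Y]
    {κ : Kernel X Y} {μ : Measure X} {f : Y → ℝ} (hf : Integrable f (κ ∘ₘ μ)) :
    ∫ y, f y ∂(κ ∘ₘ μ) = ∫ x, ∫ y, f y ∂(κ x) ∂μ := by
  rw [Measure.comp_eq_comp_const_apply] at hf ⊢
  rw [Kernel.integral_comp hf, Kernel.const_apply]

namespace CMDP

variable {S A : Type*} [MeasurableSpace S] [MeasurableSpace A] {m d : ℕ}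

theorem γ_nonneg (M : CMDP S A m) : 0 ≤ M.γ := M.γ_mem.1.le

theorem one_sub_γ_pos (M : CMDP S A m) : 0 < 1 - M.γ := sub_pos.2 M.γ_mem.2

theorem abs_r_le_one (M : CMDP S A m) (i : Fin (m + 1)) (x : S × A) : |M.r i x| ≤ 1 := by
  refine Fin.cases ?_ (fun j => ?_) i
  · have h := M.reward_mem x
    exact abs_le.2 ⟨by linarith [h.1], h.2⟩
  · exact abs_le.2 (M.utility_mem j x)

/-! ### Trajectory laws, expected returns and the Bellman equation. -/

section Trajectory

variable (M : CMDP S A m) (π : Kernel S A) [IsMarkovKernel π]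

instance isProbabilityMeasure_trajLaw (ν : Measure (S × A)) [IsProbabilityMeasure ν] :
    IsProbabilityMeasure (M.trajLaw π ν) := by
  unfold trajLaw; infer_instance

/-- The law of the trajectory as a kernel in the initial state-action pair. -/
noncomputable def trajKernel : Kernel (S × A) (ℕ → S × A) :=
  (Kernel.traj (X := fun _ => S × A) (fun n =>
    (M.step π).comap (fun h : (i : Finset.Iic n) → S × A => h ⟨n, Finset.mem_Iic.2 le_rfl⟩)
      (measurable_pi_apply _)) 0).comap
    (MeasurableEquiv.piUnique (fun _ : Finset.Iic 0 => S × A)).symm (MeasurableEquiv.measurable _)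

instance isMarkovKernel_trajKernel : IsMarkovKernel (M.trajKernel π) := by
  unfold trajKernel; infer_instance

/-- Exhibiting the law as a mixture over the initial pair makes `actionValue` measurable and lets
returns be computed by integrating it. -/
theorem trajLaw_eq_comp (ν : Measure (S × A)) : M.trajLaw π ν = M.trajKernel π ∘ₘ ν := by
  ext s hs
  rw [trajLaw, Kernel.trajMeasure, Measure.bind_apply hs (Kernel.aemeasurable _),
    Measure.bind_apply hs (Kernel.aemeasurable _), lintegral_map (Kernel.measurable_coe _ hs)
    (MeasurableEquiv.measurable _)]
  rfl

theorem trajLaw_dirac (x : S × A) : M.trajLaw π (Measure.dirac x) = M.trajKernel π x := by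
  rw [trajLaw_eq_comp, Measure.dirac_bind (Kernel.measurable _)]

theorem map_trajLaw_zero (ν : Measure (S × A)) [IsProbabilityMeasure ν] :
    (M.trajLaw π ν).map (fun τ => τ 0) = ν := by
  have h : (fun τ : ℕ → S × A => τ 0) =
      (MeasurableEquiv.piUnique (fun _ : Finset.Iic 0 => S × A)) ∘
        Preorder.frestrictLe (π := fun _ => S × A) 0 := rfl
  rw [h, ← Measure.map_map (MeasurableEquiv.measurable _) (by fun_prop), trajLaw,
    Kernel.trajMeasure, Measure.map_comp _ _ (by fun_prop), Kernel.traj_map_frestrictLe,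
    Kernel.partialTraj_self, Measure.id_comp,
    Measure.map_map (MeasurableEquiv.measurable _) (MeasurableEquiv.measurable _)]
  convert Measure.map_id
  ext x : 1
  exact MeasurableEquiv.apply_symm_apply _ x

theorem map_trajLaw_succ (ν : Measure (S × A)) [IsProbabilityMeasure ν] (t : ℕ) :
    (M.trajLaw π ν).map (fun τ => τ (t + 1)) =
      M.step π ∘ₘ (M.trajLaw π ν).map (fun τ => τ t) := by
  have h := Kernel.map_frestrictLe_trajMeasure_compProd_eq_map_trajMeasure
    (X := fun _ => S × A) (μ₀ := ν) (κ := fun n =>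
    (M.step π).comap (fun h : (i : Finset.Iic n) → S × A => h ⟨n, Finset.mem_Iic.2 le_rfl⟩)
      (measurable_pi_apply _)) (a := t)
  have h' := congrArg (fun μ => μ.map Prod.snd) h
  rw [Measure.map_map measurable_snd (by fun_prop)] at h'
  change _ = (M.trajLaw π ν).map (fun τ => τ (t + 1)) at h'
  rw [← h']
  change Measure.snd _ = _
  rw [Measure.snd_compProd]
  ext s hs
  rw [Measure.bind_apply hs (Kernel.aemeasurable _), Measure.bind_apply hs (Kernel.aemeasurable _),
    lintegral_map (Kernel.measurable_coe _ hs) (by fun_prop),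
    lintegral_map (Kernel.measurable_coe _ hs) (by fun_prop)]
  rfl

/-- Marginals suffice here, with no shift on trajectory space: the return is a sum of functions of
single coordinates. -/
theorem map_trajLaw_step (ν : Measure (S × A)) [IsProbabilityMeasure ν] (t : ℕ) :
    (M.trajLaw π (M.step π ∘ₘ ν)).map (fun τ => τ t) =
      (M.trajLaw π ν).map (fun τ => τ (t + 1)) := by
  induction t with
  | zero => rw [map_trajLaw_zero, map_trajLaw_succ, map_trajLaw_zero]
  | succ t ih => rw [map_trajLaw_succ, ih, ← map_trajLaw_succ]

theorem abs_discountedReturn_term_le (i : Fin (m + 1)) (τ : ℕ → S × A) (t : ℕ) :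
    ‖M.γ ^ t * M.r i (τ t)‖ ≤ M.γ ^ t := by
  rw [Real.norm_eq_abs, abs_mul, abs_of_nonneg (pow_nonneg M.γ_nonneg t)]
  exact mul_le_of_le_one_right (pow_nonneg M.γ_nonneg t) (M.abs_r_le_one i _)

theorem summable_γ_pow : Summable fun t : ℕ => M.γ ^ t :=
  summable_geometric_of_lt_one M.γ_nonneg M.γ_mem.2

theorem hasSum_discountedReturn (i : Fin (m + 1)) (τ : ℕ → S × A) :
    HasSum (fun t => M.γ ^ t * M.r i (τ t)) (M.discountedReturn i τ) :=
  (Summable.of_norm_bounded M.summable_γ_pow (M.abs_discountedReturn_term_le i τ)).hasSum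

theorem measurable_discountedReturn (i : Fin (m + 1)) : Measurable (M.discountedReturn i) := by
  have := M.measurable_r i
  unfold discountedReturn
  fun_prop

theorem norm_discountedReturn_le (i : Fin (m + 1)) (τ : ℕ → S × A) :
    ‖M.discountedReturn i τ‖ ≤ (1 - M.γ)⁻¹ :=
  tsum_of_norm_bounded (hasSum_geometric_of_lt_one M.γ_nonneg M.γ_mem.2)
    (M.abs_discountedReturn_term_le i τ)

/-- The expected discounted return when the initial state-action pair has law `ν`. -/
noncomputable def expReturn (i : Fin (m + 1)) (ν : Measure (S × A)) : ℝ :=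
  ∫ τ, M.discountedReturn i τ ∂(M.trajLaw π ν)

theorem integrable_discountedReturn (i : Fin (m + 1)) (μ : Measure (ℕ → S × A))
    [IsFiniteMeasure μ] : Integrable (M.discountedReturn i) μ :=
  .of_bound (M.measurable_discountedReturn i).aestronglyMeasurable _
    (.of_forall (M.norm_discountedReturn_le i))

theorem hasSum_expReturn (i : Fin (m + 1)) (ν : Measure (S × A)) [IsProbabilityMeasure ν] :
    HasSum (fun t => M.γ ^ t * ∫ x, M.r i x ∂((M.trajLaw π ν).map fun τ => τ t))
      (M.expReturn π i ν) := by
  have hm := M.measurable_r i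
  have h := hasSum_integral_of_dominated_convergence (μ := M.trajLaw π ν)
    (F := fun t τ => M.γ ^ t * M.r i (τ t)) (f := M.discountedReturn i)
    (fun t _ => M.γ ^ t) (fun t => Measurable.aestronglyMeasurable (by fun_prop))
    (fun t => .of_forall fun τ => M.abs_discountedReturn_term_le i τ t)
    (.of_forall fun _ => M.summable_γ_pow) (integrable_const _)
    (.of_forall fun τ => M.hasSum_discountedReturn i τ)
  simp_rw [integral_const_mul] at h
  have hmap (t : ℕ) : ∫ x, M.r i x ∂((M.trajLaw π ν).map fun τ => τ t) =
      ∫ τ, M.r i (τ t) ∂(M.trajLaw π ν) :=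
    integral_map (measurable_pi_apply t).aemeasurable hm.aestronglyMeasurable
  simp_rw [hmap]
  exact h

/-- Split off the term at time zero; the remaining series is `γ` times the series of the chain
started one step later. -/
theorem expReturn_eq_add (i : Fin (m + 1)) (ν : Measure (S × A)) [IsProbabilityMeasure ν] :
    M.expReturn π i ν = ∫ x, M.r i x ∂ν + M.γ * M.expReturn π i (M.step π ∘ₘ ν) := by
  have h := M.hasSum_expReturn π i ν
  have h' := (M.hasSum_expReturn π i (M.step π ∘ₘ ν)).mul_left M.γ
  rw [← hasSum_nat_add_iff' 1] at h
  simp only [Finset.range_one, Finset.sum_singleton, pow_zero, one_mul, map_trajLaw_zero] at h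
  simp only [map_trajLaw_step, ← mul_assoc, ← pow_succ'] at h'
  linarith [h.unique h']

theorem actionValue_eq_integral (i : Fin (m + 1)) (x : S × A) :
    M.actionValue π i x = ∫ τ, M.discountedReturn i τ ∂(M.trajKernel π x) := by
  rw [actionValue, trajLaw_dirac]

theorem measurable_actionValue (i : Fin (m + 1)) : Measurable (M.actionValue π i) := by
  simp_rw [funext (M.actionValue_eq_integral π i)]
  exact (M.measurable_discountedReturn i).stronglyMeasurable.integral_kernel.measurable

theorem norm_actionValue_le (i : Fin (m + 1)) (x : S × A) :
    ‖M.actionValue π i x‖ ≤ (1 - M.γ)⁻¹ := by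
  have h := norm_integral_le_of_norm_le_const (μ := M.trajLaw π (Measure.dirac x))
    (.of_forall (M.norm_discountedReturn_le i))
  rwa [probReal_univ, mul_one] at h

theorem integrable_actionValue (i : Fin (m + 1)) (μ : Measure (S × A)) [IsFiniteMeasure μ] :
    Integrable (M.actionValue π i) μ :=
  .of_bound (M.measurable_actionValue π i).aestronglyMeasurable _
    (.of_forall (M.norm_actionValue_le π i))

theorem expReturn_eq_integral (i : Fin (m + 1)) (ν : Measure (S × A)) [IsProbabilityMeasure ν] :
    M.expReturn π i ν = ∫ x, M.actionValue π i x ∂ν := by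
  simp_rw [actionValue_eq_integral]
  rw [expReturn, trajLaw_eq_comp, integral_measure_comp]
  exact M.integrable_discountedReturn i _

theorem stateValue_eq_integral (i : Fin (m + 1)) (s : S) :
    M.stateValue π i s = ∫ a, M.actionValue π i (s, a) ∂(π s) := by
  change M.expReturn π i _ = _
  rw [expReturn_eq_integral, Measure.integral_compProd (M.integrable_actionValue π i _),
    integral_dirac']
  exact (M.measurable_actionValue π i).stronglyMeasurable.integral_kernel_prod_right'

theorem measurable_stateValue (i : Fin (m + 1)) : Measurable (M.stateValue π i) := by
  simp_rw [funext (M.stateValue_eq_integral π i)]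
  exact (M.measurable_actionValue π i).stronglyMeasurable.integral_kernel_prod_right'.measurable

theorem norm_stateValue_le (i : Fin (m + 1)) (s : S) :
    ‖M.stateValue π i s‖ ≤ (1 - M.γ)⁻¹ := by
  have h := norm_integral_le_of_norm_le_const (μ := M.trajLaw π (Measure.dirac s ⊗ₘ π))
    (.of_forall (M.norm_discountedReturn_le i))
  rwa [probReal_univ, mul_one] at h

theorem expReturn_compProd (i : Fin (m + 1)) (μ : Measure S) [IsProbabilityMeasure μ] :
    M.expReturn π i (μ ⊗ₘ π) = ∫ s, M.stateValue π i s ∂μ := by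
  rw [expReturn_eq_integral, Measure.integral_compProd (M.integrable_actionValue π i _)]
  simp_rw [stateValue_eq_integral]

theorem value_eq_integral (i : Fin (m + 1)) :
    M.value π i = ∫ s, M.stateValue π i s ∂M.ρ :=
  M.expReturn_compProd π i M.ρ

theorem step_comp (ν : Measure (S × A)) [SFinite ν] :
    M.step π ∘ₘ ν = (M.P ∘ₘ ν) ⊗ₘ π := by
  ext s hs
  rw [Measure.bind_apply hs (Kernel.aemeasurable _), Measure.compProd_apply hs,
    Measure.lintegral_bind (Kernel.aemeasurable _)
      (Kernel.measurable_kernel_prodMk_left hs).aemeasurable]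
  refine lintegral_congr fun x => ?_
  rw [step, Kernel.compProd_apply hs]
  rfl

theorem step_apply (x : S × A) : M.step π x = M.P x ⊗ₘ π := by
  have h := M.step_comp π (Measure.dirac x)
  rwa [Measure.dirac_bind (Kernel.measurable _), Measure.dirac_bind (Kernel.measurable _)] at h

/-- The Bellman equation. -/
theorem actionValue_eq (i : Fin (m + 1)) (x : S × A) :
    M.actionValue π i x = M.r i x + M.γ * ∫ s, M.stateValue π i s ∂(M.P x) := by
  change M.expReturn π i _ = _
  rw [expReturn_eq_add, integral_dirac' _ _ (M.measurable_r i).stronglyMeasurable,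
    Measure.dirac_bind (Kernel.measurable _), step_apply, expReturn_compProd]

end Trajectory

/-! ### Visitation measures and the performance difference lemma. -/

section Visitation

variable (M : CMDP S A m) (π : Kernel S A) [IsMarkovKernel π]

instance isProbabilityMeasure_map_trajLaw (ν : Measure (S × A)) [IsProbabilityMeasure ν] (t : ℕ) :
    IsProbabilityMeasure ((M.trajLaw π ν).map fun τ => τ t) :=
  Measure.isProbabilityMeasure_map (measurable_pi_apply t).aemeasurable

instance isProbabilityMeasure_visitation : IsProbabilityMeasure (M.visitation π) := by
  refine ⟨?_⟩
  have h := (hasSum_geometric_of_lt_one M.γ_nonneg M.γ_mem.2).mul_left (1 - M.γ)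
  rw [mul_inv_cancel₀ M.one_sub_γ_pos.ne'] at h
  simp only [visitation, Measure.sum_apply _ MeasurableSet.univ, Measure.smul_apply, measure_univ,
    smul_eq_mul, mul_one]
  rw [← ENNReal.ofReal_tsum_of_nonneg _ h.summable, h.tsum_eq, ENNReal.ofReal_one]
  exact fun t => mul_nonneg M.one_sub_γ_pos.le (pow_nonneg M.γ_nonneg t)

/-- The discounted flow equation: the time-zero marginal is separated, and every later one is the
previous one pushed through `step`. -/
theorem visitation_eq_add :
    M.visitation π = ENNReal.ofReal (1 - M.γ) • (M.ρ ⊗ₘ π) +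
      ENNReal.ofReal M.γ • (M.step π ∘ₘ M.visitation π) := by
  ext s hs
  simp only [visitation, Measure.add_apply, Measure.smul_apply, smul_eq_mul,
    Measure.sum_apply _ hs, Measure.bind_apply hs (Kernel.aemeasurable _),
    lintegral_sum_measure, lintegral_smul_measure]
  rw [tsum_eq_zero_add' ENNReal.summable, map_trajLaw_zero, pow_zero, mul_one,
    ← ENNReal.tsum_mul_left]
  congr 2 with t
  rw [map_trajLaw_succ, Measure.bind_apply hs (Kernel.aemeasurable _), ← mul_assoc,
    ← ENNReal.ofReal_mul M.γ_nonneg]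
  congr 2
  ring

/-- The discounted state visitation distribution. -/
noncomputable def stateVisitation : Measure S :=
  ENNReal.ofReal (1 - M.γ) • M.ρ + ENNReal.ofReal M.γ • (M.P ∘ₘ M.visitation π)

instance isProbabilityMeasure_stateVisitation : IsProbabilityMeasure (M.stateVisitation π) := by
  refine ⟨?_⟩
  simp only [stateVisitation, Measure.add_apply, Measure.smul_apply, measure_univ, smul_eq_mul,
    mul_one]
  rw [← ENNReal.ofReal_add M.one_sub_γ_pos.le M.γ_nonneg, sub_add_cancel, ENNReal.ofReal_one]

/-- In both terms of the flow equation the action is drawn from `π` given the state, so `π` factors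
out. -/
theorem visitation_eq_compProd : M.visitation π = M.stateVisitation π ⊗ₘ π := by
  have : SFinite (ENNReal.ofReal M.γ • (M.P ∘ₘ M.visitation π)) := inferInstance
  conv_lhs => rw [visitation_eq_add]
  rw [step_comp, stateVisitation, Measure.compProd_add_left, Measure.compProd_smul_left,
    Measure.compProd_smul_left]

theorem integral_stateVisitation {f : S → ℝ} (hf : Measurable f) {C : ℝ} (hC : ∀ s, ‖f s‖ ≤ C) :
    ∫ s, f s ∂(M.stateVisitation π) =
      (1 - M.γ) * ∫ s, f s ∂M.ρ + M.γ * ∫ x, ∫ s, f s ∂(M.P x) ∂(M.visitation π) := by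
  have hi (μ : Measure S) [IsFiniteMeasure μ] : Integrable f μ :=
    .of_bound hf.aestronglyMeasurable _ (.of_forall hC)
  rw [stateVisitation, integral_add_measure ((hi _).smul_measure ENNReal.ofReal_ne_top)
    ((hi _).smul_measure ENNReal.ofReal_ne_top), integral_smul_measure, integral_smul_measure,
    ENNReal.toReal_ofReal M.one_sub_γ_pos.le, ENNReal.toReal_ofReal M.γ_nonneg,
    integral_measure_comp (hi _)]
  rfl

theorem integral_visitation_fst (f : S → ℝ) (hf : Measurable f) :
    ∫ x, f x.1 ∂(M.visitation π) = ∫ s, f s ∂(M.stateVisitation π) := by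
  rw [visitation_eq_compProd]
  conv_rhs => rw [← Measure.fst_compProd (M.stateVisitation π) π]
  rw [Measure.fst, integral_map measurable_fst.aemeasurable hf.aestronglyMeasurable]

theorem measurable_advantage (i : Fin (m + 1)) : Measurable (M.advantage π i) :=
  (M.measurable_actionValue π i).sub ((M.measurable_stateValue π i).comp measurable_fst)

theorem norm_advantage_le (i : Fin (m + 1)) (x : S × A) :
    ‖M.advantage π i x‖ ≤ (1 - M.γ)⁻¹ + (1 - M.γ)⁻¹ :=
  (norm_sub_le _ _).trans (add_le_add (M.norm_actionValue_le π i x) (M.norm_stateValue_le π i x.1))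

variable (π' : Kernel S A) [IsMarkovKernel π']

/-- The Bellman equation for `π` is averaged over the flow of `π'`; the expected next-state values
cancel. Taking the difference with the case where both policies are `π'` yields the performance
difference lemma. -/
theorem integral_visitation_advantage_add (i : Fin (m + 1)) :
    ∫ x, M.advantage π i x ∂(M.visitation π') + (1 - M.γ) * M.value π i =
      ∫ x, M.r i x ∂(M.visitation π') := by
  have hr : Integrable (M.r i) (M.visitation π') :=
    .of_bound (M.measurable_r i).aestronglyMeasurable 1 (.of_forall (M.abs_r_le_one i))
  have hQ := M.integrable_actionValue π i (M.visitation π')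
  have hV : Integrable (fun x => M.stateValue π i x.1) (M.visitation π') :=
    .of_bound ((M.measurable_stateValue π i).comp measurable_fst).aestronglyMeasurable _
      (.of_forall fun x => M.norm_stateValue_le π i x.1)
  have hBellman : ∫ x, M.r i x ∂(M.visitation π') = ∫ x, M.actionValue π i x ∂(M.visitation π') -
      M.γ * ∫ x, ∫ s, M.stateValue π i s ∂(M.P x) ∂(M.visitation π') := by
    have h (x : S × A) : M.γ * ∫ s, M.stateValue π i s ∂(M.P x) =
        M.actionValue π i x - M.r i x := by rw [actionValue_eq]; ring
    rw [← integral_const_mul]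
    simp_rw [h]
    rw [integral_sub hQ hr]
    ring
  have hflow := M.integral_stateVisitation π' (M.measurable_stateValue π i)
    (M.norm_stateValue_le π i)
  rw [← M.integral_visitation_fst π' _ (M.measurable_stateValue π i),
    ← M.value_eq_integral π i] at hflow
  simp only [advantage]
  rw [integral_sub hQ hV, hBellman, hflow]
  ring

theorem integral_visitation_advantage_self (i : Fin (m + 1)) :
    ∫ x, M.advantage π i x ∂(M.visitation π) = 0 := by
  have hQ := M.integrable_actionValue π i (M.visitation π)
  have hV : Integrable (fun x => M.stateValue π i x.1) (M.visitation π) :=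
    .of_bound ((M.measurable_stateValue π i).comp measurable_fst).aestronglyMeasurable _
      (.of_forall fun x => M.norm_stateValue_le π i x.1)
  simp only [advantage]
  rw [integral_sub hQ hV, integral_visitation_fst _ _ _ (M.measurable_stateValue π i)]
  simp_rw [stateValue_eq_integral]
  rw [visitation_eq_compProd] at hQ ⊢
  rw [Measure.integral_compProd hQ, sub_self]

/-- The performance difference lemma. -/
theorem value_sub_value (i : Fin (m + 1)) :
    M.value π' i - M.value π i =
      (1 - M.γ)⁻¹ * ∫ x, M.advantage π i x ∂(M.visitation π') := by
  have h := M.integral_visitation_advantage_add π π' i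
  have h' := M.integral_visitation_advantage_add π' π' i
  rw [integral_visitation_advantage_self] at h'
  rw [eq_inv_mul_iff_mul_eq₀ M.one_sub_γ_pos.ne']
  linarith

/-- Restarting the process from the law `P x` turns `Q` into a value, so continuity of values in
`θ`, proved for all processes, passes to `Q`. -/
theorem actionValue_eq_value (i : Fin (m + 1)) (x : S × A) :
    M.actionValue π i x =
      M.r i x + M.γ * CMDP.value { M with
        ρ := M.P x, isProbabilityMeasure_ρ := inferInstance } π i := by
  rw [actionValue_eq, value_eq_integral]
  rfl

end Visitation

end CMDP

/-! ### Scores and likelihood ratios. -/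

open Filter Topology

namespace PolicyClass

variable {S A : Type*} [MeasurableSpace S] [MeasurableSpace A] {d : ℕ} (p : PolicyClass S A d)

theorem hasGradientAt_log_dens (θ : EuclideanSpace ℝ (Fin d)) (x : S × A) :
    HasGradientAt (fun θ' => Real.log (p.dens θ' x.1 x.2)) (p.score θ x) θ :=
  (p.differentiable_log_dens x.1 x.2 θ).hasGradientAt

/-- Each directional derivative is a pointwise limit of measurable difference quotients with step
`1/n`. -/
theorem measurable_score (θ : EuclideanSpace ℝ (Fin d)) : Measurable (p.score θ) := by
  have hinner (v : EuclideanSpace ℝ (Fin d)) : Measurable fun x => inner ℝ (p.score θ x) v := by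
    refine measurable_of_tendsto_metrizable (f := fun (n : ℕ) (x : S × A) =>
      (n : ℝ) • (Real.log (p.dens (θ + (n : ℝ)⁻¹ • v) x.1 x.2) - Real.log (p.dens θ x.1 x.2)))
      (fun n => ?_) (tendsto_pi_nhds.2 fun x => ?_)
    · have h₁ : Measurable fun x : S × A => p.dens (θ + (n : ℝ)⁻¹ • v) x.1 x.2 :=
        p.measurable_dens _
      have h₂ : Measurable fun x : S × A => p.dens θ x.1 x.2 := p.measurable_dens _
      fun_prop
    · have h := (p.hasGradientAt_log_dens θ x).hasFDerivAt.lim v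
        (c := fun n : ℕ => (n : ℝ)) (l := atTop)
        (tendsto_norm_atTop_atTop.comp tendsto_natCast_atTop_atTop)
      simpa using h
  have hsum : p.score θ = fun x => ∑ j, inner ℝ (p.score θ x)
      (EuclideanSpace.basisFun (Fin d) ℝ j) • EuclideanSpace.basisFun (Fin d) ℝ j := by
    ext1 x
    conv_lhs => rw [← (EuclideanSpace.basisFun (Fin d) ℝ).sum_repr' (p.score θ x)]
    simp_rw [real_inner_comm]
  rw [hsum]
  exact Finset.measurable_sum _ fun j _ => (hinner _).smul_const _

/-- The likelihood ratio `π_θ'(a|s) / π_θ(a|s)`. -/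
noncomputable def ratio (θ θ' : EuclideanSpace ℝ (Fin d)) (x : S × A) : ℝ :=
  p.dens θ' x.1 x.2 / p.dens θ x.1 x.2

variable (θ θ' : EuclideanSpace ℝ (Fin d))

theorem ratio_self (x : S × A) : p.ratio θ θ x = 1 := div_self (p.dens_pos _ _ _).ne'

theorem ratio_nonneg (x : S × A) : 0 ≤ p.ratio θ θ' x :=
  (div_pos (p.dens_pos _ _ _) (p.dens_pos _ _ _)).le

theorem measurable_ratio : Measurable (p.ratio θ θ') :=
  (p.measurable_dens θ').div (p.measurable_dens θ)

theorem ratio_eq_exp (x : S × A) :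
    p.ratio θ θ' x = Real.exp (Real.log (p.dens θ' x.1 x.2) - Real.log (p.dens θ x.1 x.2)) := by
  rw [Real.exp_sub, Real.exp_log (p.dens_pos _ _ _), Real.exp_log (p.dens_pos _ _ _), ratio]

theorem hasFDerivAt_ratio (x : S × A) :
    HasFDerivAt (fun θ' => p.ratio θ θ' x)
      (InnerProductSpace.toDual ℝ (EuclideanSpace ℝ (Fin d)) (p.score θ x)) θ := by
  have h := ((p.hasGradientAt_log_dens θ x).hasFDerivAt.sub_const
    (Real.log (p.dens θ x.1 x.2))).exp
  simp only [← ratio_eq_exp, ratio_self, one_smul] at h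
  exact h

theorem policy_eq_withDensity_ratio (s : S) :
    p.policy θ' s = (p.policy θ s).withDensity fun a => ENNReal.ofReal (p.ratio θ θ' (s, a)) := by
  have h (θ) : Measurable (p.dens θ s) := (p.measurable_dens θ).of_uncurry_left
  have h' : Measurable fun a => p.ratio θ θ' (s, a) :=
    (p.measurable_ratio θ θ').comp measurable_prodMk_left
  rw [policy_apply, policy_apply, ← withDensity_mul _ (h θ).ennreal_ofReal h'.ennreal_ofReal]
  congr 1 with a
  rw [Pi.mul_apply, ← ENNReal.ofReal_mul (p.dens_pos _ _ _).le, ratio,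
    mul_div_cancel₀ _ (p.dens_pos _ _ _).ne']

theorem compProd_policy_eq_withDensity (σ : Measure S) [SFinite σ] :
    σ ⊗ₘ p.policy θ' =
      (σ ⊗ₘ p.policy θ).withDensity fun x => ENNReal.ofReal (p.ratio θ θ' x) := by
  have hw := (p.measurable_ratio θ θ').ennreal_ofReal
  ext s hs
  rw [withDensity_apply _ hs, ← lintegral_indicator hs,
    Measure.lintegral_compProd (hw.indicator hs), Measure.compProd_apply hs]
  refine lintegral_congr fun x => ?_
  rw [policy_eq_withDensity_ratio p θ θ', withDensity_apply _ (measurable_prodMk_left hs),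
    ← lintegral_indicator (measurable_prodMk_left hs)]
  rfl

theorem integral_compProd_policy (σ : Measure S) [SFinite σ] (g : S × A → ℝ) :
    ∫ x, g x ∂(σ ⊗ₘ p.policy θ') = ∫ x, p.ratio θ θ' x * g x ∂(σ ⊗ₘ p.policy θ) := by
  rw [compProd_policy_eq_withDensity p θ θ', integral_withDensity_eq_integral_toReal_smul
    (p.measurable_ratio θ θ').ennreal_ofReal (.of_forall fun _ => ENNReal.ofReal_lt_top)]
  simp_rw [ENNReal.toReal_ofReal (p.ratio_nonneg θ θ' _), smul_eq_mul]

theorem integrable_ratio_mul (σ : Measure S) [IsProbabilityMeasure σ] {g : S × A → ℝ}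
    (hg : Measurable g) {C : ℝ} (hC : ∀ x, ‖g x‖ ≤ C) :
    Integrable (fun x => p.ratio θ θ' x * g x) (σ ⊗ₘ p.policy θ) := by
  have h : Integrable g (σ ⊗ₘ p.policy θ') :=
    .of_bound hg.aestronglyMeasurable _ (.of_forall hC)
  rw [compProd_policy_eq_withDensity p θ θ', integrable_withDensity_iff
    (p.measurable_ratio θ θ').ennreal_ofReal (.of_forall fun _ => ENNReal.ofReal_lt_top)] at h
  simpa only [ENNReal.toReal_ofReal (p.ratio_nonneg θ θ' _), mul_comm] using h

theorem integrable_ratio (σ : Measure S) [IsProbabilityMeasure σ] :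
    Integrable (p.ratio θ θ') (σ ⊗ₘ p.policy θ) := by
  simpa using p.integrable_ratio_mul θ θ' σ (g := fun _ => 1) measurable_const (C := 1) (by simp)

theorem integral_ratio (σ : Measure S) [IsProbabilityMeasure σ] :
    ∫ x, p.ratio θ θ' x ∂(σ ⊗ₘ p.policy θ) = 1 := by
  simpa using (p.integral_compProd_policy θ θ' σ fun _ => 1).symm

theorem tendsto_ratio (x : S × A) : Tendsto (fun θ' => p.ratio θ θ' x) (𝓝 θ) (𝓝 1) := by
  simpa only [ratio_self] using (p.hasFDerivAt_ratio θ x).continuousAt.tendsto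

/-- Scheffé's lemma for the likelihood ratio. -/
theorem tendsto_integral_abs_ratio_sub_one (σ : Measure S) [IsProbabilityMeasure σ] :
    Tendsto (fun θ' => ∫ x, |p.ratio θ θ' x - 1| ∂(σ ⊗ₘ p.policy θ)) (𝓝 θ) (𝓝 0) := by
  have hmeas (θ') : AEStronglyMeasurable (fun x => max (1 - p.ratio θ θ' x) 0)
      (σ ⊗ₘ p.policy θ) :=
    ((measurable_const.sub (p.measurable_ratio θ θ')).max measurable_const).aestronglyMeasurable
  have hbound (θ') (x) : ‖max (1 - p.ratio θ θ' x) 0‖ ≤ 1 := by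
    rw [Real.norm_of_nonneg (le_max_right _ _)]
    exact max_le (by linarith [p.ratio_nonneg θ θ' x]) zero_le_one
  have hlim : Tendsto (fun θ' => ∫ x, max (1 - p.ratio θ θ' x) 0 ∂(σ ⊗ₘ p.policy θ)) (𝓝 θ)
      (𝓝 (∫ _, (0 : ℝ) ∂(σ ⊗ₘ p.policy θ))) := by
    refine tendsto_integral_filter_of_dominated_convergence (fun _ => 1)
      (.of_forall hmeas) (.of_forall fun θ' => .of_forall (hbound θ')) (integrable_const _)
      (.of_forall fun x => ?_)
    simpa using ((p.tendsto_ratio θ x).const_sub 1).max (tendsto_const_nhds (x := (0 : ℝ)))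
  rw [integral_zero] at hlim
  have heq (θ') : ∫ x, |p.ratio θ θ' x - 1| ∂(σ ⊗ₘ p.policy θ) =
      2 * ∫ x, max (1 - p.ratio θ θ' x) 0 ∂(σ ⊗ₘ p.policy θ) := by
    -- The term `ratio - 1` integrates to zero, leaving a negative part bounded by `1`, to which
    -- dominated convergence applies.
    have h (x) : |p.ratio θ θ' x - 1| =
        (p.ratio θ θ' x - 1) + 2 * max (1 - p.ratio θ θ' x) 0 := by
      rcases le_total (p.ratio θ θ' x) 1 with h | h
      · rw [abs_of_nonpos (by linarith), max_eq_left (by linarith)]; ring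
      · rw [abs_of_nonneg (by linarith), max_eq_right (by linarith)]; ring
    have hi := p.integrable_ratio θ θ' σ
    have hi' : Integrable (fun x => max (1 - p.ratio θ θ' x) 0) (σ ⊗ₘ p.policy θ) :=
      .of_bound (hmeas θ') 1 (.of_forall (hbound θ'))
    simp_rw [h]
    rw [integral_add (f := fun x => p.ratio θ θ' x - 1) (hi.sub (integrable_const _))
      (hi'.const_mul 2),
      integral_sub hi (integrable_const _), integral_ratio, integral_const_mul]
    simp
  simp_rw [heq]
  simpa using hlim.const_mul 2

end PolicyClass

/-! ### Continuity and differentiability of the values in the parameter. -/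

namespace CMDP

variable {S A : Type*} [MeasurableSpace S] [MeasurableSpace A] {m d : ℕ}
  (M : CMDP S A m) (p : PolicyClass S A d) (i : Fin (m + 1)) (θ θ' : EuclideanSpace ℝ (Fin d))

theorem integrable_ratio_sub_one_mul_actionValue :
    Integrable (fun x => (p.ratio θ θ' x - 1) * M.actionValue (p.policy θ') i x)
      (M.visitation (p.policy θ)) := by
  have h₁ := M.integrable_actionValue (p.policy θ') i (M.visitation (p.policy θ))
  rw [visitation_eq_compProd] at h₁ ⊢
  have h₂ := p.integrable_ratio_mul θ θ' (M.stateVisitation (p.policy θ))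
    (M.measurable_actionValue (p.policy θ') i) (M.norm_actionValue_le (p.policy θ') i)
  simp_rw [sub_mul, one_mul]
  exact h₂.sub h₁

/-- The performance difference lemma with the advantage taken at `θ'` and the visitation at `θ`. All
dependence on `θ'` sits in the integrand, so the visitation measure never has to be differentiated.
-/
theorem paramValue_sub_paramValue :
    M.paramValue p i θ' - M.paramValue p i θ = (1 - M.γ)⁻¹ *
      ∫ x, (p.ratio θ θ' x - 1) * M.actionValue (p.policy θ') i x
        ∂(M.visitation (p.policy θ)) := by
  have hV : Integrable (fun x : S × A => M.stateValue (p.policy θ') i x.1)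
      (M.visitation (p.policy θ)) :=
    .of_bound ((M.measurable_stateValue _ i).comp measurable_fst).aestronglyMeasurable _
      (.of_forall fun x => M.norm_stateValue_le _ i x.1)
  have h₁ := M.integrable_actionValue (p.policy θ') i (M.visitation (p.policy θ))
  have h₂ := p.integrable_ratio_mul θ θ' (M.stateVisitation (p.policy θ))
    (M.measurable_actionValue (p.policy θ') i) (M.norm_actionValue_le (p.policy θ') i)
  have h₃ : ∫ x : S × A, M.stateValue (p.policy θ') i x.1 ∂(M.visitation (p.policy θ)) =
      ∫ x, p.ratio θ θ' x * M.actionValue (p.policy θ') i x ∂(M.visitation (p.policy θ)) := by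
    rw [integral_visitation_fst _ _ _ (M.measurable_stateValue _ i), visitation_eq_compProd,
      ← p.integral_compProd_policy,
      Measure.integral_compProd (M.integrable_actionValue (p.policy θ') i _)]
    simp_rw [stateValue_eq_integral]
  rw [← visitation_eq_compProd] at h₂
  simp_rw [sub_mul, one_mul]
  rw [integral_sub h₂ h₁, ← h₃, ← neg_sub (M.paramValue p i θ), paramValue, paramValue,
    value_sub_value]
  simp_rw [advantage]
  rw [integral_sub h₁ hV]
  ring

/-- `Q` is bounded by `(1 - γ)⁻¹` uniformly in `θ'`, so `L¹` convergence of the ratio is enough. -/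
theorem tendsto_paramValue : Tendsto (M.paramValue p i) (𝓝 θ) (𝓝 (M.paramValue p i θ)) := by
  rw [tendsto_iff_norm_sub_tendsto_zero]
  have hlim := (p.tendsto_integral_abs_ratio_sub_one θ (M.stateVisitation (p.policy θ))).const_mul
    ((1 - M.γ)⁻¹ * (1 - M.γ)⁻¹)
  rw [mul_zero] at hlim
  refine squeeze_zero (fun _ => norm_nonneg _) (fun θ' => ?_) hlim
  have hγ : 0 ≤ (1 - M.γ)⁻¹ := inv_nonneg.2 M.one_sub_γ_pos.le
  rw [paramValue_sub_paramValue, norm_mul, Real.norm_of_nonneg hγ, mul_assoc,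
    ← visitation_eq_compProd]
  refine mul_le_mul_of_nonneg_left ?_ hγ
  rw [← integral_const_mul]
  refine norm_integral_le_of_norm_le ?_ (.of_forall fun x => ?_)
  · have h := p.integrable_ratio θ θ' (M.stateVisitation (p.policy θ))
    rw [← visitation_eq_compProd] at h
    exact (h.sub (integrable_const 1)).abs.const_mul _
  · rw [norm_mul, mul_comm, Real.norm_eq_abs (p.ratio θ θ' x - 1)]
    exact mul_le_mul_of_nonneg_right (M.norm_actionValue_le _ i x) (abs_nonneg _)

theorem tendsto_actionValue (x : S × A) :
    Tendsto (fun θ' => M.actionValue (p.policy θ') i x) (𝓝 θ)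
      (𝓝 (M.actionValue (p.policy θ) i x)) := by
  simp_rw [actionValue_eq_value]
  exact ((tendsto_paramValue _ p i θ).const_mul _).const_add _

variable {M p θ}

theorem eventually_mem_feasible (hθ : ∀ i : Fin m, 0 < M.paramValue p i.succ θ) :
    ∀ᶠ θ' in 𝓝 θ, θ' ∈ M.feasible p := by
  have h : ∀ᶠ θ' in 𝓝 θ, ∀ i : Fin m, 0 < M.paramValue p i.succ θ' :=
    eventually_all.2 fun i => (M.tendsto_paramValue p i.succ θ).eventually_const_lt (hθ i)
  exact h.mono fun θ' h' i => (h' i).le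

theorem mem_feasible_of_pos (hθ : ∀ i : Fin m, 0 < M.paramValue p i.succ θ) : θ ∈ M.feasible p :=
  fun i => (hθ i).le

/-- On a ball inside the feasible set, `log dens` is `Mg`-Lipschitz in the parameter. The factor `2`
is from `|exp u - 1| ≤ 2|u|` for `|u| ≤ 1`. -/
theorem eventually_abs_ratio_sub_one_le {Mg : ℝ} (hscore : M.BoundedScore p Mg)
    (hθ : ∀ i : Fin m, 0 < M.paramValue p i.succ θ) :
    ∀ᶠ θ' in 𝓝 θ, ∀ x, |p.ratio θ θ' x - 1| ≤ 2 * (Mg * ‖θ' - θ‖) := by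
  obtain ⟨δ, hδ, hball⟩ := Metric.eventually_nhds_iff_ball.1 (eventually_mem_feasible hθ)
  have hsmall : ∀ᶠ θ' in 𝓝 θ, Mg * ‖θ' - θ‖ < 1 := by
    have : Tendsto (fun θ' => Mg * ‖θ' - θ‖) (𝓝 θ) (𝓝 (Mg * ‖θ - θ‖)) :=
      Continuous.tendsto (by fun_prop) θ
    rw [sub_self, norm_zero, mul_zero] at this
    exact this.eventually_lt_const one_pos
  filter_upwards [hsmall, Metric.ball_mem_nhds θ hδ] with θ' hθ' hmem x
  have hlip := Convex.norm_image_sub_le_of_norm_fderiv_le (𝕜 := ℝ)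
    (f := fun θ' => Real.log (p.dens θ' x.1 x.2)) (C := Mg) (s := Metric.ball θ δ)
    (fun θ₁ _ => p.differentiable_log_dens x.1 x.2 θ₁)
    (fun θ₁ h₁ => by
      rw [(p.hasGradientAt_log_dens θ₁ x).hasFDerivAt.fderiv, LinearIsometryEquiv.norm_map]
      exact hscore θ₁ (hball θ₁ h₁) x)
    (convex_ball θ δ) (Metric.mem_ball_self hδ) hmem
  rw [p.ratio_eq_exp]
  exact (Real.abs_exp_sub_one_le (hlip.trans hθ'.le)).trans
    (mul_le_mul_of_nonneg_left hlip zero_le_two)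

theorem norm_inv_norm_mul_inner_le {E : Type*} [NormedAddCommGroup E] [InnerProductSpace ℝ E]
    (u v : E) : ‖‖v‖⁻¹ * inner ℝ u v‖ ≤ ‖u‖ := by
  rw [norm_mul, norm_inv, norm_norm]
  exact inv_mul_le_of_le_mul₀ (norm_nonneg _) (norm_nonneg _)
    (by simpa only [mul_comm] using norm_inner_le_norm (𝕜 := ℝ) u v)

variable (M p θ)

/-- The integrand of the first-order remainder of `V_i^θ'` at `θ`, divided by `‖θ' - θ‖`. -/
noncomputable def gradientRemainder (x : S × A) : ℝ :=
  ‖θ' - θ‖⁻¹ * ((p.ratio θ θ' x - 1) * M.actionValue (p.policy θ') i x -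
    M.actionValue (p.policy θ) i x * inner ℝ (p.score θ x) (θ' - θ))

theorem measurable_gradientRemainder : Measurable (M.gradientRemainder p i θ θ') := by
  have h₁ := p.measurable_ratio θ θ'
  have h₂ := M.measurable_actionValue (p.policy θ') i
  have h₃ := M.measurable_actionValue (p.policy θ) i
  have h₄ : Measurable fun x => inner ℝ (p.score θ x) (θ' - θ) :=
    (p.measurable_score θ).inner measurable_const
  exact (((h₁.sub_const 1).mul h₂).sub (h₃.mul h₄)).const_mul _

theorem tendsto_gradientRemainder (x : S × A) :
    Tendsto (fun θ' => M.gradientRemainder p i θ θ' x) (𝓝 θ) (𝓝 0) := by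
  have hw := hasFDerivAt_iff_tendsto.1 (p.hasFDerivAt_ratio θ x)
  have hQlim := tendsto_iff_norm_sub_tendsto_zero.1 (M.tendsto_actionValue p i θ x)
  have hsq := (hw.mul_const (1 - M.γ)⁻¹).add (hQlim.const_mul ‖p.score θ x‖)
  rw [zero_mul, mul_zero, add_zero] at hsq
  refine squeeze_zero_norm (fun θ' => ?_) hsq
  -- Pairing the linearization error of the ratio with `Q` at `θ'` leaves only a difference of `Q`s,
  -- for which continuity suffices.
  have hsplit : M.gradientRemainder p i θ θ' x = ‖θ' - θ‖⁻¹ * (p.ratio θ θ' x - p.ratio θ θ x -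
        InnerProductSpace.toDual ℝ _ (p.score θ x) (θ' - θ)) * M.actionValue (p.policy θ') i x +
      (‖θ' - θ‖⁻¹ * inner ℝ (p.score θ x) (θ' - θ)) *
        (M.actionValue (p.policy θ') i x - M.actionValue (p.policy θ) i x) := by
    rw [gradientRemainder, InnerProductSpace.toDual_apply_apply, p.ratio_self]
    ring
  rw [hsplit]
  refine (norm_add_le _ _).trans (add_le_add ?_ ?_)
  · rw [norm_mul, norm_mul, norm_inv, norm_norm]
    exact mul_le_mul_of_nonneg_left (M.norm_actionValue_le _ i x)
      (mul_nonneg (inv_nonneg.2 (norm_nonneg _)) (norm_nonneg _))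
  · rw [norm_mul]
    exact mul_le_mul_of_nonneg_right (norm_inv_norm_mul_inner_le _ _) (norm_nonneg _)

variable {M p θ}

theorem eventually_norm_gradientRemainder_le {Mg : ℝ} (hscore : M.BoundedScore p Mg)
    (hθ : ∀ i : Fin m, 0 < M.paramValue p i.succ θ) :
    ∀ᶠ θ' in 𝓝 θ, ∀ x, ‖M.gradientRemainder p i θ θ' x‖ ≤ 3 * Mg * (1 - M.γ)⁻¹ := by
  have hγ : 0 ≤ (1 - M.γ)⁻¹ := inv_nonneg.2 M.one_sub_γ_pos.le
  filter_upwards [eventually_abs_ratio_sub_one_le hscore hθ] with θ' h x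
  have hfeas := hscore θ (mem_feasible_of_pos hθ) x
  have hMg : 0 ≤ Mg := (norm_nonneg _).trans hfeas
  -- The constant `3` is this `2` from the ratio plus `1` from the linear term.
  have h₁ : ‖‖θ' - θ‖⁻¹ * (p.ratio θ θ' x - 1)‖ ≤ 2 * Mg := by
    rw [norm_mul, norm_inv, norm_norm]
    refine inv_mul_le_of_le_mul₀ (norm_nonneg _) (by linarith) ((h x).trans_eq ?_)
    ring
  have h₂ := (norm_inv_norm_mul_inner_le (p.score θ x) (θ' - θ)).trans hfeas
  have hsplit : M.gradientRemainder p i θ θ' x =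
      ‖θ' - θ‖⁻¹ * (p.ratio θ θ' x - 1) * M.actionValue (p.policy θ') i x -
        ‖θ' - θ‖⁻¹ * inner ℝ (p.score θ x) (θ' - θ) * M.actionValue (p.policy θ) i x := by
    rw [gradientRemainder]
    ring
  rw [hsplit]
  refine (norm_sub_le _ _).trans ?_
  rw [norm_mul _ (M.actionValue (p.policy θ') i x), norm_mul _ (M.actionValue (p.policy θ) i x)]
  have h₃ := mul_le_mul h₁ (M.norm_actionValue_le (p.policy θ') i x) (norm_nonneg _)
    (by linarith)
  have h₄ := mul_le_mul h₂ (M.norm_actionValue_le (p.policy θ) i x) (norm_nonneg _) hMg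
  linarith

/-- The policy gradient theorem. -/
theorem hasGradientAt_paramValue {Mg : ℝ} (hscore : M.BoundedScore p Mg)
    (hθ : ∀ i : Fin m, 0 < M.paramValue p i.succ θ) :
    HasGradientAt (M.paramValue p i) ((1 - M.γ)⁻¹ •
      ∫ x, M.actionValue (p.policy θ) i x • p.score θ x ∂(M.visitation (p.policy θ))) θ := by
  have hγ : 0 ≤ (1 - M.γ)⁻¹ := inv_nonneg.2 M.one_sub_γ_pos.le
  have hint : Integrable (fun x => M.actionValue (p.policy θ) i x • p.score θ x)
      (M.visitation (p.policy θ)) := by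
    refine .of_bound ((M.measurable_actionValue (p.policy θ) i).smul
      (p.measurable_score θ)).aestronglyMeasurable ((1 - M.γ)⁻¹ * Mg) (.of_forall fun x => ?_)
    rw [norm_smul]
    exact mul_le_mul (M.norm_actionValue_le _ i x) (hscore θ (mem_feasible_of_pos hθ) x)
      (norm_nonneg _) hγ
  have hrem (θ' : EuclideanSpace ℝ (Fin d)) :
      ‖θ' - θ‖⁻¹ * ‖M.paramValue p i θ' - M.paramValue p i θ -
        InnerProductSpace.toDual ℝ _ ((1 - M.γ)⁻¹ • ∫ x, M.actionValue (p.policy θ) i x •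
          p.score θ x ∂(M.visitation (p.policy θ))) (θ' - θ)‖ =
      (1 - M.γ)⁻¹ * ‖∫ x, M.gradientRemainder p i θ θ' x ∂(M.visitation (p.policy θ))‖ := by
    have hint' : Integrable (fun x =>
        M.actionValue (p.policy θ) i x * inner ℝ (p.score θ x) (θ' - θ))
        (M.visitation (p.policy θ)) := by
      simpa only [real_inner_smul_left] using hint.inner_const (𝕜 := ℝ) (θ' - θ)
    have hin : InnerProductSpace.toDual ℝ _ ((1 - M.γ)⁻¹ •
        ∫ x, M.actionValue (p.policy θ) i x • p.score θ x ∂(M.visitation (p.policy θ)))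
          (θ' - θ) =
        (1 - M.γ)⁻¹ * ∫ x, M.actionValue (p.policy θ) i x * inner ℝ (p.score θ x) (θ' - θ)
          ∂(M.visitation (p.policy θ)) := by
      rw [InnerProductSpace.toDual_apply_apply, real_inner_smul_left, real_inner_comm,
        ← integral_inner hint]
      simp_rw [real_inner_smul_right, real_inner_comm]
    simp only [gradientRemainder]
    rw [hin, paramValue_sub_paramValue, ← mul_sub, ← integral_sub
      (M.integrable_ratio_sub_one_mul_actionValue p i θ θ') hint', integral_const_mul,
      norm_mul, norm_mul, Real.norm_of_nonneg hγ, norm_inv, norm_norm]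
    ring
  rw [hasGradientAt_iff_hasFDerivAt, hasFDerivAt_iff_tendsto]
  simp_rw [hrem]
  have hlim := tendsto_integral_filter_of_dominated_convergence (μ := M.visitation (p.policy θ))
    (fun _ => 3 * Mg * (1 - M.γ)⁻¹)
    (.of_forall fun θ' => (M.measurable_gradientRemainder p i θ θ').aestronglyMeasurable)
    ((eventually_norm_gradientRemainder_le i hscore hθ).mono fun θ' h => .of_forall h)
    (integrable_const _) (.of_forall fun x => M.tendsto_gradientRemainder p i θ x)
  rw [integral_zero] at hlim
  simpa using hlim.norm.const_mul (1 - M.γ)⁻¹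

end CMDP

/-! ### The pseudoinverse bound and the optimality gap. -/

open scoped Matrix.Norms.L2Operator in
theorem norm_symmPinv_le {d : ℕ} {F : Matrix (Fin d) (Fin d) ℝ} {c : ℝ} (hc : 0 < c)
    (hF : ∀ ev : ℝ, Module.End.HasEigenvalue (Matrix.toLin' F) ev → ev ≠ 0 → c ≤ ev)
    (v : EuclideanSpace ℝ (Fin d)) :
    ‖Matrix.toEuclideanLin (symmPinv F) v‖ ≤ c⁻¹ * ‖v‖ := by
  refine (Matrix.l2_opNorm_mulVec (symmPinv F) v).trans
    (mul_le_mul_of_nonneg_right ?_ (norm_nonneg v))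
  refine norm_cfc_le (inv_nonneg.2 hc.le) fun x hx => ?_
  rcases eq_or_ne x 0 with rfl | h0
  -- The convention `0⁻¹ = 0` makes the zero eigenvalue harmless.
  · simpa using hc.le
  have hx' : Module.End.HasEigenvalue (Matrix.toLin' F) x := by
    rw [Module.End.hasEigenvalue_iff_mem_spectrum, Matrix.spectrum_toLin']
    exact hx
  have := hF x hx' h0
  rw [norm_inv, Real.norm_of_nonneg (hc.le.trans this)]
  exact inv_anti₀ hc this

/-- Nonnegativity of the variance. -/
theorem integral_le_sqrt_integral_sq {X : Type*} [MeasurableSpace X] {μ : Measure X}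
    [IsProbabilityMeasure μ] {f : X → ℝ} (hf : MemLp f 2 μ) :
    ∫ x, f x ∂μ ≤ √(∫ x, f x ^ 2 ∂μ) := by
  refine Real.le_sqrt_of_sq_le ?_
  have h := variance_eq_sub hf
  have h' := variance_nonneg f μ
  simp only [Pi.pow_apply] at h
  linarith

namespace CMDP

variable {S A : Type*} [MeasurableSpace S] [MeasurableSpace A] {m d : ℕ}
  {M : CMDP S A m} {p : PolicyClass S A d} {θ : EuclideanSpace ℝ (Fin d)}

theorem hasGradientAt_logBarrier (η : ℝ)
    (hdiff : ∀ i, DifferentiableAt ℝ (M.paramValue p i) θ)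
    (hθ : ∀ i : Fin m, 0 < M.paramValue p i.succ θ) :
    HasGradientAt (M.logBarrier p η) (gradient (M.paramValue p 0) θ +
      ∑ i : Fin m, (η / M.paramValue p i.succ θ) • gradient (M.paramValue p i.succ) θ) θ := by
  rw [hasGradientAt_iff_hasFDerivAt]
  have hlog (i : Fin m) := (hdiff i.succ).hasGradientAt.hasFDerivAt.log (hθ i).ne'
  have h := (hdiff 0).hasGradientAt.hasFDerivAt.add
    ((HasFDerivAt.fun_sum (u := Finset.univ) fun i _ => hlog i).const_mul η)
  refine h.congr_fderiv ?_
  simp only [map_add, map_sum, map_smul, Finset.smul_sum, smul_smul, div_eq_mul_inv]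

theorem naturalGradient_add_sum (η : ℝ)
    (hdiff : ∀ i, DifferentiableAt ℝ (M.paramValue p i) θ)
    (hθ : ∀ i : Fin m, 0 < M.paramValue p i.succ θ) :
    M.naturalGradient p 0 θ +
      ∑ i : Fin m, (η / M.paramValue p i.succ θ) • M.naturalGradient p i.succ θ =
      Matrix.toEuclideanLin (symmPinv (M.fisher p θ)) (gradient (M.logBarrier p η) θ) := by
  rw [(hasGradientAt_logBarrier η hdiff hθ).gradient]
  simp only [naturalGradient, map_add, map_sum, map_smul]

theorem integrable_score {Mg : ℝ} (hs : ∀ x, ‖p.score θ x‖ ≤ Mg) (μ : Measure (S × A))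
    [IsFiniteMeasure μ] : Integrable (p.score θ) μ :=
  .of_bound (p.measurable_score θ).aestronglyMeasurable _ (.of_forall hs)

theorem value_sub_paramValue_le {π' : Kernel S A} [IsMarkovKernel π'] {Mg ε : ℝ}
    (hs : ∀ x, ‖p.score θ x‖ ≤ Mg) (hbias : M.BoundedTransferErrorAt p π' θ ε)
    (i : Fin (m + 1)) :
    M.value π' i - M.paramValue p i θ ≤ √ε / (1 - M.γ) +
      inner ℝ (M.naturalGradient p i θ) (∫ x, p.score θ x ∂(M.visitation π')) := by
  have hint := integrable_score hs (M.visitation π')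
  have hinner : Integrable
      (fun x => (1 - M.γ) * inner ℝ (M.naturalGradient p i θ) (p.score θ x)) (M.visitation π') :=
    (hint.const_inner _).const_mul _
  have hA : Integrable (M.advantage (p.policy θ) i) (M.visitation π') :=
    .of_bound (M.measurable_advantage _ i).aestronglyMeasurable _
      (.of_forall (M.norm_advantage_le _ i))
  have hLp : MemLp (fun x => M.advantage (p.policy θ) i x -
      (1 - M.γ) * inner ℝ (M.naturalGradient p i θ) (p.score θ x)) 2 (M.visitation π') := by
    refine .of_bound (hA.sub hinner).aestronglyMeasurable
      ((1 - M.γ)⁻¹ + (1 - M.γ)⁻¹ + (1 - M.γ) * (‖M.naturalGradient p i θ‖ * Mg))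
      (.of_forall fun x => (norm_sub_le _ _).trans (add_le_add (M.norm_advantage_le _ i x) ?_))
    rw [norm_mul, Real.norm_of_nonneg M.one_sub_γ_pos.le]
    exact mul_le_mul_of_nonneg_left ((norm_inner_le_norm _ _).trans
      (mul_le_mul_of_nonneg_left (hs x) (norm_nonneg _))) M.one_sub_γ_pos.le
  have hCS := (integral_le_sqrt_integral_sq hLp).trans (Real.sqrt_le_sqrt (hbias i))
  rw [integral_sub hA hinner, integral_const_mul, integral_inner hint] at hCS
  rw [paramValue, value_sub_value, div_eq_inv_mul, inv_mul_le_iff₀ M.one_sub_γ_pos, mul_add,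
    mul_inv_cancel_left₀ M.one_sub_γ_pos.ne']
  linarith

end CMDP

theorem mainTheorem4 {S A : Type*} [MeasurableSpace S] [MeasurableSpace A] {m d : ℕ}
    (M : CMDP S A m) (p : PolicyClass S A d)
    (πstar : Kernel S A) [IsMarkovKernel πstar] (hopt : M.IsOptimalPolicy πstar)
    (Mg : ℝ) (hscore : M.BoundedScore p Mg)
    (η : ℝ) (hη : 0 < η)
    (θ : EuclideanSpace ℝ (Fin d)) (hθ : ∀ i : Fin m, 0 < M.paramValue p i.succ θ)
    (μF : ℝ) (hμF : 0 < μF) (hF : M.RelaxedFisherNondegenerateAt p θ μF)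
    (εbias : ℝ) (hbias : M.BoundedTransferErrorAt p πstar θ εbias) :
    (∀ i, DifferentiableAt ℝ (M.paramValue p i) θ) ∧
      DifferentiableAt ℝ (M.logBarrier p η) θ ∧
      M.value πstar 0 - M.paramValue p 0 θ ≤
        m * η
          + Real.sqrt εbias / (1 - M.γ) * (1 + ∑ i : Fin m, η / M.paramValue p i.succ θ)
          + Mg / μF * ‖gradient (M.logBarrier p η) θ‖ := by
  have hdiff (i) : DifferentiableAt ℝ (M.paramValue p i) θ :=
    (CMDP.hasGradientAt_paramValue i hscore hθ).differentiableAt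
  refine ⟨hdiff, (CMDP.hasGradientAt_logBarrier η hdiff hθ).differentiableAt, ?_⟩
  have hs := hscore θ (CMDP.mem_feasible_of_pos hθ)
  have hgap := CMDP.value_sub_paramValue_le hs hbias
  set g := ∫ x, p.score θ x ∂(M.visitation πstar) with hg
  have hgnorm : ‖g‖ ≤ Mg := by
    have h := norm_integral_le_of_norm_le_const (μ := M.visitation πstar) (.of_forall hs)
    rwa [probReal_univ, mul_one] at h
  -- Because `g` does not depend on `i`, linearity collects the natural gradients into one vector
  -- before Cauchy–Schwarz is applied.
  have hdual : inner ℝ (M.naturalGradient p 0 θ) g +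
      ∑ i : Fin m, η / M.paramValue p i.succ θ * inner ℝ (M.naturalGradient p i.succ θ) g ≤
      Mg / μF * ‖gradient (M.logBarrier p η) θ‖ := by
    have hlin := congrArg (fun v => inner ℝ v g) (CMDP.naturalGradient_add_sum η hdiff hθ)
    simp only [inner_add_left, sum_inner, real_inner_smul_left] at hlin
    rw [hlin]
    refine (real_inner_le_norm _ _).trans ((mul_le_mul (norm_symmPinv_le hμF hF _) hgnorm
      (norm_nonneg _) (by positivity)).trans_eq ?_)
    ring
  -- Since `V_i^{π*} ≥ 0`, the weighted gap `(η / V_i^θ)(V_i^{π*} - V_i^θ)` is at least `-η`.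
  have hterm (i : Fin m) : -η ≤ η / M.paramValue p i.succ θ * (√εbias / (1 - M.γ)) +
      η / M.paramValue p i.succ θ * inner ℝ (M.naturalGradient p i.succ θ) g := by
    rw [← mul_add]
    refine le_trans ?_ (mul_le_mul_of_nonneg_left (hgap i.succ) (div_pos hη (hθ i)).le)
    rw [mul_sub, div_mul_cancel₀ _ (hθ i).ne']
    linarith [mul_nonneg (div_pos hη (hθ i)).le (hopt.1 i)]
  have hsum := Finset.sum_le_sum fun (i : Fin m) (_ : i ∈ Finset.univ) => hterm i
  rw [Finset.sum_add_distrib, ← Finset.sum_mul, Finset.sum_const, Finset.card_univ,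
    Fintype.card_fin, nsmul_eq_mul] at hsum
  linarith [hgap 0]
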